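/- Let $p$ be a prime, let $k\ge 2$ and $t$ be integers with $2\le t<\frac{\sqrt p}{4}$, and put $\mathcal R=\mathbb Z/p^k\mathbb Z$. A line in $\mathcal R^2$ is a set of the form $\{a+sb:\ s\in\mathcal R\}$ with $a,b\in\mathcal R^2$, where at least one coordinate of $b$ is invertible in $\mathcal R$. A set $S\subseteq\mathcal R^2$ is covered by $m$ lines if $S\subseteq L_1\cup\dots\cup L_m$ for some lines $L_1,\dots,L_m$, and it is nearly covered by $m$ lines if it is not covered by $m$ lines but each of its proper subsets is (so that, in particular, $S\setminus\{x\}$ is covered by $m$ lines for each $x\in S$). Define $\ell$ and $M$ as follows: if $k=2$, let $\ell=M=1$; if $k\ge 3$, let $\ell=\lfloor\log_p k\rfloor+2$ and $M=\lfloor (k-1)/\ell\rfloor$. Let $t'=t+M-1$. Then there is a set $S\subseteq(\mathbb Z/p^k\mathbb Z)^2$ of size $$|S|=2^M\binom{t+1}{2}+2^M-1$$ that is nearly covered by $t'$ lines. Its size satisfies $|S|>\binom{t'+2}{2}$. Moreover, if $p>k\ge 3$, then $\ell=2$ and $M=\lfloor (k-1)/2\rfloor$, so that $|S|=2^{\lfloor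 (k-1)/2\rfloor}\left(\binom{t+1}{2}+1\right)-1$ and $t'=t+\lfloor (k-1)/2\rfloor-1$. -/

import Mathlib

/-- A vector of `Rⁿ` represents a direction if at least one of its coordinates is invertible. -/
def IsDirection {R : Type*} [CommRing R] {n : ℕ} (b : Fin n → R) : Prop :=
  ∃ j, IsUnit (b j)

/-- A line in `Rⁿ`: a set of the form `{a + s b : s ∈ R}`, where `b` is a direction. -/
def IsLine {R : Type*} [CommRing R] {n : ℕ} (L : Set (Fin n → R)) : Prop :=
  ∃ a b : Fin n → R, IsDirection b ∧ L = {x | ∃ s : R, x = a + s • b}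

/-- `S` is covered by `t` lines: it is contained in the union of some lines `L₁, …, L_t`. -/
def IsCoveredByLines {R : Type*} [CommRing R] {n : ℕ} (t : ℕ) (S : Set (Fin n → R)) : Prop :=
  ∃ L : Fin t → Set (Fin n → R), (∀ i, IsLine (L i)) ∧ S ⊆ ⋃ i, L i

/-- `S` is nearly covered by `t` lines: it is not covered by `t` lines, but each of its proper
subsets is. -/
def IsNearlyCoveredByLines {R : Type*} [CommRing R] {n : ℕ} (t : ℕ) (S : Set (Fin n → R)) :
    Prop :=
  ¬ IsCoveredByLines t S ∧ ∀ T : Set (Fin n → R), T ⊂ S → IsCoveredByLines t T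

/-- The parameter `ℓ`: it is `1` if `k = 2`, and `⌊log_p k⌋ + 2` if `k ≥ 3`. -/
def scaleStep (p k : ℕ) : ℕ :=
  if k = 2 then 1 else Nat.log p k + 2

/-- The parameter `M`: it is `1` if `k = 2`, and `⌊(k - 1) / ℓ⌋` if `k ≥ 3`. -/
def scaleCount (p k : ℕ) : ℕ :=
  if k = 2 then 1 else (k - 1) / scaleStep p k

/-! Work with integer points and congruences `u x + v y ≡ w` modulo `p ^ n`, `(u, v)` primitive. A
triangle with `t` points on each side is nearly covered by `t - 1` lines. It is then doubled `M`
times; each doubling adds `ℓ = e + 1` to the exponent and one line, and turns `|S|` into `2|S| + 1`.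

A doubling (`flatDouble`) takes two copies of `S`, flattened vertically by `p ^ ℓ` and `p ^ (n + e)`
apart horizontally, and a point `z = (r, 1)`. A line through `z` misses one copy of each point
(`not_both_copies`), so the other lines of a cover, unflattened by `exists_line_of_flat`, would
cover `S`. Conversely, a cover of `S` minus a point lifts to both copies, and one more line joins
`z` to the copy that is left.

The lift must not see the horizontal shift, so its `x`-coefficient must be divisible by `p`. This is
why deletions are covered finely: a `y`-coefficient of valuation `s ≤ e` comes with precision `n +
s`. The joining line is again fine because `r` is a new abscissa modulo `p ^ ℓ`; `ℓ` is large enough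
for all the abscissas needed. -/

theorem int_dvd_congr {a b c d : ℤ} (h : a ∣ b) (hac : a = c) (hbd : b = d) : c ∣ d :=
  hac ▸ hbd ▸ h

/-! ### Covers by congruences -/

/-- `S` is covered, modulo `p ^ n`, by `m` lines `u x + v y = w` with `(u, v)` primitive. -/
def CoveredMod (p n m : ℕ) (S : Finset (ℤ × ℤ)) : Prop :=
  ∃ u v w : Fin m → ℤ, (∀ i, ¬ ((p : ℤ) ∣ u i ∧ (p : ℤ) ∣ v i)) ∧
    ∀ P ∈ S, ∃ i, (p : ℤ) ^ n ∣ u i * P.1 + v i * P.2 - w i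

/-- `S` is covered by `m` lines `u x + p ^ s d y = w` with `s ≤ e` and `d` prime to `p`, where the
equation holds to the precision `p ^ (n + s)`. -/
def FinelyCoveredMod (p e n m : ℕ) (S : Finset (ℤ × ℤ)) : Prop :=
  ∃ (s : Fin m → ℕ) (u d w : Fin m → ℤ),
    (∀ i, s i ≤ e ∧ ¬ (p : ℤ) ∣ d i ∧ (s i = 0 ∨ ¬ (p : ℤ) ∣ u i)) ∧
    ∀ P ∈ S, ∃ i, (p : ℤ) ^ (n + s i) ∣ u i * P.1 + (p : ℤ) ^ s i * d i * P.2 - w i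

/-- A set nearly covered by `m` lines modulo `p ^ n`, with finely covered one-point deletions, whose
abscissas modulo `p ^ (e + 1)` are among `0, …, r - 1`. -/
structure FinelyNearlyCovered (p e n m r : ℕ) (S : Finset (ℤ × ℤ)) : Prop where
  not_covered : ¬ CoveredMod p n m S
  covered_erase : ∀ P ∈ S, FinelyCoveredMod p e n m (S.erase P)
  injOn : ∀ P ∈ S, ∀ Q ∈ S, (p : ℤ) ^ n ∣ P.1 - Q.1 → (p : ℤ) ^ n ∣ P.2 - Q.2 → P = Q
  abscissa : ∀ P ∈ S, ∃ j : ℕ, j < r ∧ (p : ℤ) ^ (e + 1) ∣ P.1 - j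

theorem FinelyCoveredMod.coveredMod {p e n m : ℕ} {S : Finset (ℤ × ℤ)}
    (h : FinelyCoveredMod p e n m S) : CoveredMod p n m S := by
  obtain ⟨s, u, d, w, h1, h2⟩ := h
  refine ⟨u, fun i => (p : ℤ) ^ s i * d i, w, ?_, ?_⟩
  · rintro i ⟨hu, hv⟩
    obtain ⟨-, hd, h | h⟩ := h1 i
    · exact hd (by simpa [h] using hv)
    · exact h hu
  · intro P hP
    obtain ⟨i, hi⟩ := h2 P hP
    exact ⟨i, (pow_dvd_pow _ (Nat.le_add_right _ _)).trans hi⟩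

theorem FinelyCoveredMod.of_erase {p e n m : ℕ} (hp : p.Prime) {S : Finset (ℤ × ℤ)} {P : ℤ × ℤ}
    (h : FinelyCoveredMod p e n m (S.erase P)) : FinelyCoveredMod p e n (m + 1) S := by
  obtain ⟨s, u, d, w, h1, h2⟩ := h
  refine ⟨Fin.cons 0 s, Fin.cons 0 u, Fin.cons 1 d, Fin.cons P.2 w, ?_, ?_⟩
  · intro i
    refine Fin.cases ?_ (fun i => ?_) i
    · have := (Nat.prime_iff_prime_int.1 hp).not_dvd_one
      simp [this]
    · simpa using h1 i
  · intro Q hQ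
    by_cases hPQ : Q = P
    · exact ⟨0, by simp [hPQ]⟩
    · obtain ⟨i, hi⟩ := h2 Q (Finset.mem_erase.2 ⟨hPQ, hQ⟩)
      exact ⟨i.succ, by simpa using hi⟩

/-! ### Flattening and doubling -/

/-- Two copies of `S`, flattened by the factor `p ^ (e + 1)` and shifted horizontally by
`p ^ (n + e)`, together with the point `(r, 1)`. -/
def flatDouble (p e n r : ℕ) (S : Finset (ℤ × ℤ)) : Finset (ℤ × ℤ) :=
  insert ((r : ℤ), 1)
    (S.image (fun P => (P.1, (p : ℤ) ^ (e + 1) * P.2)) ∪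
      S.image (fun P => (P.1 + (p : ℤ) ^ (n + e), (p : ℤ) ^ (e + 1) * P.2)))

theorem mem_flatDouble {p e n r : ℕ} {S : Finset (ℤ × ℤ)} {Q : ℤ × ℤ} :
    Q ∈ flatDouble p e n r S ↔ Q = ((r : ℤ), 1) ∨ ∃ P ∈ S, ∃ c : ℤ, (c = 0 ∨ c = 1) ∧
      Q = (P.1 + c * (p : ℤ) ^ (n + e), (p : ℤ) ^ (e + 1) * P.2) := by
  simp only [flatDouble, Finset.mem_insert, Finset.mem_union, Finset.mem_image]
  constructor
  · rintro (h | ⟨P, hP, rfl⟩ | ⟨P, hP, rfl⟩)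
    · exact Or.inl h
    · exact Or.inr ⟨P, hP, 0, by simp⟩
    · exact Or.inr ⟨P, hP, 1, by simp⟩
  · rintro (h | ⟨P, hP, c, rfl | rfl, rfl⟩)
    · exact Or.inl h
    · exact Or.inr (Or.inl ⟨P, hP, by simp⟩)
    · exact Or.inr (Or.inr ⟨P, hP, by simp⟩)

/-- The points of the flattened plane on a line modulo `p ^ (n + ℓ)` lie on a line modulo `p ^ n`
before flattening. -/
theorem exists_line_of_flat {p : ℕ} (hp : p.Prime) (n l : ℕ) (hl : 1 ≤ l) (u v w : ℤ)
    (huv : ¬ ((p : ℤ) ∣ u ∧ (p : ℤ) ∣ v)) :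
    ∃ u' v' w' : ℤ, ¬ ((p : ℤ) ∣ u' ∧ (p : ℤ) ∣ v') ∧
      ∀ x y : ℤ, (p : ℤ) ^ (n + l) ∣ u * x + v * ((p : ℤ) ^ l * y) - w →
        (p : ℤ) ^ n ∣ u' * x + v' * y - w' := by
  have hp0 : (p : ℤ) ≠ 0 := by exact_mod_cast hp.ne_zero
  -- The equation is divided by the largest power of `p`, at most `p ^ l`, that divides `u`.
  by_cases hu : (p : ℤ) ^ l ∣ u
  · have hv : ¬ (p : ℤ) ∣ v := fun h => huv ⟨(dvd_pow_self _ (by omega)).trans hu, h⟩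
    obtain ⟨u', rfl⟩ := hu
    by_cases hw : (p : ℤ) ^ l ∣ w
    · obtain ⟨w', rfl⟩ := hw
      refine ⟨u', v, w', fun h => hv h.2, fun x y h => ?_⟩
      have h2 : (p : ℤ) ^ l * (p : ℤ) ^ n ∣ (p : ℤ) ^ l * (u' * x + v * y - w') := by
        exact int_dvd_congr (h) (by ring) (by ring)
      exact Int.dvd_of_mul_dvd_mul_left (pow_ne_zero _ hp0) h2
    -- Here the line contains no flattened point, so the constant `0` is arbitrary.
    · refine ⟨u', v, 0, fun h => hv h.2, fun x y h => absurd ?_ hw⟩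
      have h1 := (pow_dvd_pow (p : ℤ) (Nat.le_add_left l n)).trans h
      have h2 : w = (p : ℤ) ^ l * (u' * x + v * y) -
        ((p : ℤ) ^ l * u' * x + v * ((p : ℤ) ^ l * y) - w) := by ring
      rw [h2]
      exact dvd_sub (dvd_mul_right _ _) h1
  · obtain ⟨j, u', hu', rfl⟩ : ∃ (j : ℕ) (u' : ℤ), ¬ (p : ℤ) ∣ u' ∧ u = (p : ℤ) ^ j * u' := by
      have hu0 : u ≠ 0 := by
        rintro rfl
        exact hu (dvd_zero _)
      obtain ⟨u', h1, h2⟩ := (Int.finiteMultiplicity_iff.2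
        ⟨by simpa using hp.ne_one, hu0⟩ :
          FiniteMultiplicity (p : ℤ) u).exists_eq_pow_mul_and_not_dvd
      exact ⟨_, u', h2, h1⟩
    have hj : j < l := by
      by_contra hj
      exact hu ((pow_dvd_pow _ (not_lt.1 hj)).trans (dvd_mul_right _ _))
    obtain ⟨i, rfl⟩ := Nat.exists_eq_add_of_lt hj
    by_cases hw : (p : ℤ) ^ j ∣ w
    · obtain ⟨w', rfl⟩ := hw
      refine ⟨u', v * (p : ℤ) ^ (i + 1), w', fun h => hu' h.1, fun x y h => ?_⟩
      have h2 : (p : ℤ) ^ j * (p : ℤ) ^ (n + (i + 1)) ∣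
          (p : ℤ) ^ j * (u' * x + v * (p : ℤ) ^ (i + 1) * y - w') := by
        exact int_dvd_congr (h) (by ring) (by ring)
      exact (pow_dvd_pow _ (Nat.le_add_right _ _)).trans
        (Int.dvd_of_mul_dvd_mul_left (pow_ne_zero _ hp0) h2)
    · refine ⟨u', v, 0, fun h => hu' h.1, fun x y h => absurd ?_ hw⟩
      have h1 := (pow_dvd_pow (p : ℤ) (show j ≤ n + (j + i + 1) by omega)).trans h
      have h2 : w = (p : ℤ) ^ j * (u' * x + v * (p : ℤ) ^ (i + 1) * y) -
        ((p : ℤ) ^ j * u' * x + v * ((p : ℤ) ^ (j + i + 1) * y) - w) := by ring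
      rw [h2]
      exact dvd_sub (dvd_mul_right _ _) h1

/-- A line modulo `p ^ (n + e + 1)` through `(r, 1)` misses one of the two copies of each point. -/
theorem not_both_copies {p : ℕ} (hp : p.Prime) {n e : ℕ} {u v w r x y : ℤ}
    (huv : ¬ ((p : ℤ) ∣ u ∧ (p : ℤ) ∣ v))
    (hz : (p : ℤ) ^ (n + (e + 1)) ∣ u * r + v * 1 - w)
    (h0 : (p : ℤ) ^ (n + (e + 1)) ∣ u * (x + 0 * (p : ℤ) ^ (n + e)) +
      v * ((p : ℤ) ^ (e + 1) * y) - w)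
    (h1 : (p : ℤ) ^ (n + (e + 1)) ∣ u * (x + 1 * (p : ℤ) ^ (n + e)) +
      v * ((p : ℤ) ^ (e + 1) * y) - w) : False := by
  have hp0 : (p : ℤ) ≠ 0 := by exact_mod_cast hp.ne_zero
  -- The copies differ by `p ^ (n + e)` in `x`, which forces `p ∣ u`. Modulo `p` the line would be
  -- horizontal, yet it contains points of ordinates `1` and `0`.
  have hu : (p : ℤ) ∣ u := by
    have h := dvd_sub h1 h0
    have h2 : (p : ℤ) ^ (n + e) * p ∣ (p : ℤ) ^ (n + e) * u := by
      exact int_dvd_congr (h) (by ring) (by ring)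
    exact Int.dvd_of_mul_dvd_mul_left (pow_ne_zero _ hp0) h2
  refine huv ⟨hu, ?_⟩
  have h := (dvd_pow_self (p : ℤ) (show n + (e + 1) ≠ 0 by omega)).trans (dvd_sub hz h0)
  have h3 : v = (u * r + v * 1 - w - (u * (x + 0 * (p : ℤ) ^ (n + e)) +
      v * ((p : ℤ) ^ (e + 1) * y) - w)) - u * (r - x) + p * (v * (p : ℤ) ^ e * y) := by ring
  rw [h3]
  exact dvd_add (dvd_sub h (hu.mul_right _)) (dvd_mul_right _ _)

/-- Dropping a line through `(r, 1)` leaves `m` lines that still contain a copy of each point. They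
unflatten to a cover of `S`, since the shift vanishes modulo `p ^ n`. -/
theorem not_coveredMod_flatDouble {p : ℕ} (hp : p.Prime) {e n m r : ℕ} {S : Finset (ℤ × ℤ)}
    (h : ¬ CoveredMod p n m S) :
    ¬ CoveredMod p (n + (e + 1)) (m + 1) (flatDouble p e n r S) := by
  rintro ⟨u, v, w, huv, hcov⟩
  obtain ⟨i₀, hi₀⟩ := hcov _ (mem_flatDouble.2 (Or.inl rfl))
  choose u' v' w' huv' hl using fun i =>
    exists_line_of_flat hp n (e + 1) (by omega) (u i) (v i) (w i) (huv i)
  refine h ⟨fun i => u' (i₀.succAbove i), fun i => v' (i₀.succAbove i),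
    fun i => w' (i₀.succAbove i), fun i => huv' _, fun P hP => ?_⟩
  obtain ⟨c, i, hi, hc⟩ : ∃ (c : ℤ) (i : Fin (m + 1)), i ≠ i₀ ∧
      (p : ℤ) ^ (n + (e + 1)) ∣ u i * (P.1 + c * (p : ℤ) ^ (n + e)) +
        v i * ((p : ℤ) ^ (e + 1) * P.2) - w i := by
    obtain ⟨i, hi⟩ := hcov _ (mem_flatDouble.2 (Or.inr ⟨P, hP, 0, Or.inl rfl, rfl⟩))
    obtain ⟨j, hj⟩ := hcov _ (mem_flatDouble.2 (Or.inr ⟨P, hP, 1, Or.inr rfl, rfl⟩))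
    by_cases h0 : i = i₀
    · by_cases h1 : j = i₀
      · subst h0 h1
        exact (not_both_copies hp (huv j) hi₀ hi hj).elim
      · exact ⟨1, j, h1, hj⟩
    · exact ⟨0, i, h0, hi⟩
  obtain ⟨k, rfl⟩ := Fin.exists_succAbove_eq hi
  refine ⟨k, ?_⟩
  have h1 := hl _ _ _ hc
  have h2 : (p : ℤ) ^ n ∣ u' (i₀.succAbove k) * (c * (p : ℤ) ^ (n + e)) :=
    ((pow_dvd_pow _ (Nat.le_add_right _ _)).mul_left _).mul_left _
  exact int_dvd_congr (dvd_sub h1 h2) rfl (by ring)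

/-- Fine covers survive flattening and doubling. -/
theorem FinelyCoveredMod.flat {p e n m : ℕ} {S : Finset (ℤ × ℤ)}
    (h : FinelyCoveredMod p e n m S) :
    ∃ (u d w : Fin m → ℤ), (∀ i, ¬ (p : ℤ) ∣ d i) ∧ ∀ P ∈ S, ∃ i, ∀ c : ℤ,
      (p : ℤ) ^ (n + (e + 1)) ∣ u i * (P.1 + c * (p : ℤ) ^ (n + e)) +
        d i * ((p : ℤ) ^ (e + 1) * P.2) - w i := by
  obtain ⟨s, u, d, w, h1, h2⟩ := h
  choose f hf using fun i => Nat.exists_eq_add_of_le (h1 i).1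
  -- With `f = e - s`, multiplication by `p ^ (f + 1)` turns `p ^ s * d` into `d` times the
  -- flattening factor and the precision `n + s` into `n + e + 1`. The factor `p` gained by `u`
  -- absorbs the shift.
  refine ⟨fun i => (p : ℤ) ^ (f i + 1) * u i, d, fun i => (p : ℤ) ^ (f i + 1) * w i,
    fun i => (h1 i).2.1, fun P hP => ?_⟩
  obtain ⟨i, hi⟩ := h2 P hP
  refine ⟨i, fun c => ?_⟩
  have h3 := mul_dvd_mul_left ((p : ℤ) ^ (f i + 1)) hi
  have h4 : (p : ℤ) ^ (n + (e + 1)) ∣ (p : ℤ) ^ (n + (e + 1)) *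
    ((p : ℤ) ^ (f i) * u i * c) := dvd_mul_right _ _
  have h5 : (p : ℤ) ^ (e + 1) = (p : ℤ) ^ (f i + 1) * (p : ℤ) ^ (s i) := by
    rw [← pow_add]; congr 1; have := hf i; omega
  have h6 : (p : ℤ) ^ (n + (e + 1)) = (p : ℤ) ^ (f i + 1) * (p : ℤ) ^ (n + s i) := by
    rw [← pow_add]; congr 1; have := hf i; omega
  rw [← h6] at h3
  refine int_dvd_congr (dvd_add h3 h4) rfl ?_
  rw [h5, ← add_assoc n e 1, pow_succ (p : ℤ) (n + e)]
  ring

/-- If `(r, 1)` is deleted, `m + 1` lines covering `S` lift to both copies. If a copy of `P` is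
deleted, `m` lifted lines cover the copies of the other points, and the last line joins `(r, 1)` to
the other copy of `P`. Lifted lines have `s = 0`. -/
theorem finelyCoveredMod_flatDouble_erase {p : ℕ} (hp : p.Prime) {e n m r : ℕ}
    (hn : 1 ≤ n) (hr : r < p ^ (e + 1)) {S : Finset (ℤ × ℤ)}
    (h : FinelyNearlyCovered p e n m r S) :
    ∀ P ∈ flatDouble p e n r S,
      FinelyCoveredMod p e (n + (e + 1)) (m + 1) ((flatDouble p e n r S).erase P) := by
  have hpZ := Nat.prime_iff_prime_int.1 hp
  intro Q hQ
  rcases mem_flatDouble.1 hQ with rfl | ⟨P, hP, c, hc, rfl⟩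
  · have hS : FinelyCoveredMod p e n (m + 1) S := by
      rcases S.eq_empty_or_nonempty with rfl | ⟨P, hP⟩
      · exact ⟨0, 0, 1, 0, by simp [hpZ.not_dvd_one], by simp⟩
      · exact (h.covered_erase P hP).of_erase hp
    obtain ⟨u, d, w, hd, hcov⟩ := hS.flat
    refine ⟨0, u, d, w, fun i => by simp [hd i], fun R hR => ?_⟩
    obtain ⟨hne, hR⟩ := Finset.mem_erase.1 hR
    rcases mem_flatDouble.1 hR with rfl | ⟨P, hP, c, -, rfl⟩
    · exact absurd rfl hne
    · obtain ⟨i, hi⟩ := hcov P hP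
      exact ⟨i, by simpa using hi c⟩
  · obtain ⟨u, d, w, hd, hcov⟩ := (h.covered_erase P hP).flat
    obtain ⟨c', hc'⟩ : ∃ c' : ℤ, ∀ c'' : ℤ, (c'' = 0 ∨ c'' = 1) → c'' = c ∨ c'' = c' := by
      rcases hc with rfl | rfl
      · exact ⟨1, fun _ h => h⟩
      · exact ⟨0, fun _ h => h.symm⟩
    set X : ℤ := P.1 + c' * (p : ℤ) ^ (n + e) with hX
    set Y : ℤ := (p : ℤ) ^ (e + 1) * P.2 with hY
    have hXr : ¬ (p : ℤ) ^ (e + 1) ∣ r - X := by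
      intro hdvd
      obtain ⟨j, hj, hPj⟩ := h.abscissa P hP
      have h1 : (p : ℤ) ^ (e + 1) ∣ (p : ℤ) ^ (n + e) := pow_dvd_pow _ (by omega)
      have h2 : (p : ℤ) ^ (e + 1) ∣ ((r - j : ℕ) : ℤ) := by
        have h3 := dvd_add (dvd_add hdvd hPj) (h1.mul_left c')
        rw [Nat.cast_sub hj.le]
        exact int_dvd_congr h3 rfl (by rw [hX]; ring)
      have h4 : p ^ (e + 1) ∣ r - j := by exact_mod_cast h2
      have := Nat.le_of_dvd (by omega) h4
      omega
    obtain ⟨s, b, hb, hrX⟩ : ∃ (s : ℕ) (b : ℤ), ¬ (p : ℤ) ∣ b ∧ r - X = (p : ℤ) ^ s * b := by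
      have h0 : (r : ℤ) - X ≠ 0 := by
        intro h0
        exact hXr (h0 ▸ dvd_zero _)
      obtain ⟨b, h1, h2⟩ := (Int.finiteMultiplicity_iff.2
        ⟨by simpa using hp.ne_one, h0⟩ :
          FiniteMultiplicity (p : ℤ) (r - X)).exists_eq_pow_mul_and_not_dvd
      exact ⟨_, b, h2, h1⟩
    have hs : s ≤ e := by
      by_contra hs
      exact hXr (hrX ▸ (pow_dvd_pow _ (by omega)).trans (dvd_mul_right _ _))
    -- The line joining `(r, 1)` to `(X, Y)` is an exact integer equation, valid to any precision;
    -- `Y - 1` is prime to `p` because `p ∣ Y`.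
    refine ⟨Fin.cons s 0, Fin.cons (Y - 1) u, Fin.cons b d,
      Fin.cons ((Y - 1) * X + (p : ℤ) ^ s * b * Y) w, ?_, ?_⟩
    · intro i
      refine Fin.cases ?_ (fun i => ?_) i
      · refine ⟨by simpa using hs, by simpa using hb, Or.inr ?_⟩
        intro h1
        have h1 : (p : ℤ) ∣ Y - 1 := by simpa using h1
        have h2 : (p : ℤ) ∣ Y := (dvd_pow_self _ (by omega)).mul_right _
        exact hpZ.not_dvd_one (by simpa using dvd_sub h2 h1)
      · simpa using hd i
    · intro R hR
      obtain ⟨hne, hR⟩ := Finset.mem_erase.1 hR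
      rcases mem_flatDouble.1 hR with rfl | ⟨P', hP', c'', hc'', rfl⟩
      · refine ⟨0, ?_⟩
        simp only [Fin.cons_zero]
        have : (Y - 1) * (r : ℤ) + (p : ℤ) ^ s * b * 1 -
            ((Y - 1) * X + (p : ℤ) ^ s * b * Y) = 0 := by
          rw [← hrX]; ring
        rw [this]
        exact dvd_zero _
      · by_cases hPP : P' = P
        · subst hPP
          rcases hc' c'' hc'' with rfl | rfl
          · exact absurd rfl hne
          · refine ⟨0, ?_⟩
            simp [← hX, ← hY]
        · obtain ⟨i, hi⟩ := hcov P' (Finset.mem_erase.2 ⟨hPP, hP'⟩)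
          exact ⟨i.succ, by simpa using hi c''⟩

theorem not_dvd_one_sub_pow_mul {p : ℕ} (hp : p.Prime) {n e : ℕ} (y : ℤ) :
    ¬ (p : ℤ) ^ (n + (e + 1)) ∣ 1 - (p : ℤ) ^ (e + 1) * y := by
  intro h
  have h1 : (p : ℤ) ∣ 1 - (p : ℤ) ^ (e + 1) * y := (dvd_pow_self _ (by omega)).trans h
  have h2 : (p : ℤ) ∣ (p : ℤ) ^ (e + 1) * y := (dvd_pow_self _ (by omega)).mul_right _
  exact (Nat.prime_iff_prime_int.1 hp).not_dvd_one (by simpa using dvd_add h1 h2)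

theorem pow_succ_dvd_mul_pow {p : ℕ} (hp : p.Prime) {a : ℕ} {c : ℤ}
    (h : (p : ℤ) ^ (a + 1) ∣ c * (p : ℤ) ^ a) : (p : ℤ) ∣ c := by
  have hp0 : (p : ℤ) ≠ 0 := by exact_mod_cast hp.ne_zero
  rw [pow_succ'] at h
  exact Int.dvd_of_mul_dvd_mul_right (pow_ne_zero _ hp0) h

theorem FinelyNearlyCovered.flatDouble_injOn {p : ℕ} (hp : p.Prime) {e n m r : ℕ}
    {S : Finset (ℤ × ℤ)} (h : FinelyNearlyCovered p e n m r S) :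
    ∀ P ∈ flatDouble p e n r S, ∀ Q ∈ flatDouble p e n r S,
      (p : ℤ) ^ (n + (e + 1)) ∣ P.1 - Q.1 → (p : ℤ) ^ (n + (e + 1)) ∣ P.2 - Q.2 → P = Q := by
  have hp0 : (p : ℤ) ≠ 0 := by exact_mod_cast hp.ne_zero
  intro P hP Q hQ h1 h2
  rcases mem_flatDouble.1 hP with rfl | ⟨A, hA, a, ha, rfl⟩ <;>
    rcases mem_flatDouble.1 hQ with rfl | ⟨B, hB, b, hb, rfl⟩
  · rfl
  · exact (not_dvd_one_sub_pow_mul hp _ h2).elim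
  · exact (not_dvd_one_sub_pow_mul hp _ ((dvd_sub_comm).1 h2)).elim
  · simp only at h1 h2
    have hAB : A = B := by
      refine h.injOn A hA B hB ?_ ?_
      · have h3 := (pow_dvd_pow (p : ℤ) (Nat.le_add_right n (e + 1))).trans h1
        have h4 : (p : ℤ) ^ n ∣ (b - a) * (p : ℤ) ^ (n + e) :=
          (pow_dvd_pow _ (Nat.le_add_right _ _)).mul_left _
        exact int_dvd_congr (dvd_add h3 h4) rfl (by ring)
      · have h3 : (p : ℤ) ^ (e + 1) * (p : ℤ) ^ n ∣ (p : ℤ) ^ (e + 1) * (A.2 - B.2) := by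
          exact int_dvd_congr (h2) (by ring) (by ring)
        exact Int.dvd_of_mul_dvd_mul_left (pow_ne_zero _ hp0) h3
    subst hAB
    have h3 : (p : ℤ) ∣ a - b := by
      refine pow_succ_dvd_mul_pow hp (a := n + e) ?_
      exact int_dvd_congr (h1) rfl (by ring)
    have hp1 := (Nat.prime_iff_prime_int.1 hp).not_dvd_one
    rcases ha with rfl | rfl <;> rcases hb with rfl | rfl
    · rfl
    · exact (hp1 (by simpa using h3)).elim
    · exact (hp1 (by simpa using h3)).elim
    · rfl

theorem card_flatDouble {p : ℕ} (hp : p.Prime) {e n r : ℕ} {S : Finset (ℤ × ℤ)}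
    (h : ∀ P ∈ S, ∀ Q ∈ S, (p : ℤ) ^ n ∣ P.1 - Q.1 → (p : ℤ) ^ n ∣ P.2 - Q.2 → P = Q) :
    (flatDouble p e n r S).card = 2 * S.card + 1 := by
  have hp0 : (p : ℤ) ≠ 0 := by exact_mod_cast hp.ne_zero
  have hpe := pow_ne_zero (e + 1) hp0
  rw [flatDouble, Finset.card_insert_of_notMem, Finset.card_union_of_disjoint,
    Finset.card_image_of_injective, Finset.card_image_of_injective]
  · ring
  · rintro ⟨a, b⟩ ⟨c, d⟩ hab
    simpa [hpe] using hab
  · rintro ⟨a, b⟩ ⟨c, d⟩ hab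
    simpa [hpe] using hab
  · rw [Finset.disjoint_left]
    intro Q hQ hQ'
    obtain ⟨A, hA, rfl⟩ := Finset.mem_image.1 hQ
    obtain ⟨B, hB, hAB⟩ := Finset.mem_image.1 hQ'
    obtain ⟨h1, h2⟩ := Prod.mk.inj hAB
    have h2 : B.2 = A.2 := mul_left_cancel₀ hpe h2
    have h3 : A = B := by
      refine h A hA B hB ?_ (by simp [h2])
      rw [← h1]
      simp [pow_add]
    subst h3
    have : (p : ℤ) ^ (n + e) = 0 := by linarith
    exact pow_ne_zero _ hp0 this
  · intro hmem
    have h1 : ∃ y : ℤ, (1 : ℤ) = (p : ℤ) ^ (e + 1) * y := by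
      rcases Finset.mem_union.1 hmem with hm | hm <;>
      · obtain ⟨A, -, hA⟩ := Finset.mem_image.1 hm
        exact ⟨A.2, (Prod.mk.inj hA).2.symm⟩
    obtain ⟨y, hy⟩ := h1
    exact not_dvd_one_sub_pow_mul hp (n := 0) (e := e) y (by rw [← hy]; simp)

theorem FinelyNearlyCovered.flatDouble {p : ℕ} (hp : p.Prime) {e n m r : ℕ} (hn : 1 ≤ n)
    (hr : r < p ^ (e + 1)) {S : Finset (ℤ × ℤ)} (h : FinelyNearlyCovered p e n m r S) :
    FinelyNearlyCovered p e (n + (e + 1)) (m + 1) (r + 1) (flatDouble p e n r S) where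
  not_covered := not_coveredMod_flatDouble hp h.not_covered
  covered_erase := finelyCoveredMod_flatDouble_erase hp hn hr h
  injOn := h.flatDouble_injOn hp
  abscissa := by
    intro Q hQ
    rcases mem_flatDouble.1 hQ with rfl | ⟨P, hP, c, -, rfl⟩
    · exact ⟨r, by omega, by simp⟩
    · obtain ⟨j, hj, hd⟩ := h.abscissa P hP
      refine ⟨j, by omega, ?_⟩
      have h1 : (p : ℤ) ^ (e + 1) ∣ c * (p : ℤ) ^ (n + e) :=
        (pow_dvd_pow _ (by omega)).mul_left _
      exact int_dvd_congr (dvd_add hd h1) rfl (by ring)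

/-! ### The starting triangle -/

/-- The triangle of points `(i - j + m, j)` with `i + j ≤ m`. -/
def triangle (m : ℕ) : Finset (ℤ × ℤ) :=
  (Finset.HasAntidiagonal.antidiagonal m).biUnion fun q => (Finset.range (q.1 + 1)).image
    fun i : ℕ => ((i : ℤ) - (q.2 : ℤ) + m, (q.2 : ℤ))

theorem mem_triangle {m : ℕ} {P : ℤ × ℤ} :
    P ∈ triangle m ↔ ∃ i j : ℕ, i + j ≤ m ∧ P = ((i : ℤ) - j + m, (j : ℤ)) := by
  simp only [triangle, Finset.mem_biUnion, Finset.HasAntidiagonal.mem_antidiagonal, Finset.mem_image,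
    Finset.mem_range]
  constructor
  · rintro ⟨⟨a, b⟩, hab, i, hi, rfl⟩
    exact ⟨i, b, by simp only at hab hi; omega, rfl⟩
  · rintro ⟨i, j, hij, rfl⟩
    exact ⟨(m - j, j), by simp only; omega, i, by simp only; omega, rfl⟩

theorem card_triangle (m : ℕ) : (triangle m).card = (m + 2).choose 2 := by
  rw [triangle, Finset.card_biUnion]
  · have h : ∀ q ∈ Finset.HasAntidiagonal.antidiagonal m, ((Finset.range (q.1 + 1)).image
        fun i : ℕ => ((i : ℤ) - (q.2 : ℤ) + m, (q.2 : ℤ))).card = q.1 + 1 := by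
      intro q _
      rw [Finset.card_image_of_injective, Finset.card_range]
      intro a b hab
      simpa using hab
    rw [Finset.sum_congr rfl h, Finset.Nat.sum_antidiagonal_eq_sum_range_succ_mk]
    have h2 := Finset.sum_range_id_mul_two (m + 2)
    rw [Finset.sum_range_succ'] at h2
    rw [Nat.choose_two_right]
    simp only [Nat.succ_eq_add_one] at h2 ⊢
    omega
  · rintro ⟨a, b⟩ ha ⟨c, d⟩ hc hne
    rw [Function.onFun, Finset.disjoint_left]
    intro P hP hP'
    obtain ⟨i, -, rfl⟩ := Finset.mem_image.1 hP
    obtain ⟨j, -, hj⟩ := Finset.mem_image.1 hP'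
    have hbd : (d : ℤ) = b := (Prod.mk.inj hj).2
    simp only [SetLike.mem_coe, Finset.HasAntidiagonal.mem_antidiagonal] at ha hc
    exact hne (by ext <;> simp only <;> omega)

theorem int_eq_of_dvd_sub {p a b : ℕ} (ha : a < p) (hb : b < p) (h : (p : ℤ) ∣ a - b) :
    a = b :=
  (Nat.ModEq.eq_of_lt_of_lt ((Nat.modEq_iff_dvd).2 h) hb ha).symm

/-- A triangle with `m + 1` points on each side is not covered by `m` lines modulo `p`. -/
theorem exists_triangle_point_not_covered {p : ℕ} (hp : p.Prime) (m : ℕ) (hm : m < p) (a b : ℤ)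
    (u v w : Fin m → ℤ) (huv : ∀ i, ¬ ((p : ℤ) ∣ u i ∧ (p : ℤ) ∣ v i)) :
    ∃ i j : ℕ, i + j ≤ m ∧ ∀ k, ¬ (p : ℤ) ∣ u k * (i - j + a) + v k * (j + b) - w k := by
  have hpZ := Nat.prime_iff_prime_int.1 hp
  induction m generalizing a b with
  | zero => exact ⟨0, 0, le_rfl, fun k => k.elim0⟩
  | succ m ih =>
    by_contra! hcon
    have hrow : ∀ i : Fin (m + 2), ∃ k, (p : ℤ) ∣ u k * ((i : ℕ) + a) + v k * b - w k := by
      intro i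
      obtain ⟨k, hk⟩ := hcon i 0 (by omega)
      exact ⟨k, by simpa using hk⟩
    choose f hf using hrow
    -- The bottom row has `m + 2` points for `m + 1` lines; a line with two of them is horizontal
    -- modulo `p` and misses all the other rows.
    obtain ⟨i, i', hne, hii⟩ := Fintype.exists_ne_map_eq_of_card_lt f (by simp)
    have hu : (p : ℤ) ∣ u (f i) := by
      have h1 := dvd_sub (hf i) (hii ▸ hf i')
      have h2 : (p : ℤ) ∣ u (f i) * (((i : ℕ) : ℤ) - (i' : ℕ)) := by
        exact int_dvd_congr (h1) rfl (by ring)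
      refine (hpZ.dvd_or_dvd h2).resolve_right fun h3 => hne (Fin.ext ?_)
      exact int_eq_of_dvd_sub (by omega) (by omega) h3
    have hv : ¬ (p : ℤ) ∣ v (f i) := fun h => huv _ ⟨hu, h⟩
    -- Without that line and the bottom row, a smaller triangle remains; its corner moves left by
    -- one because of the shear.
    obtain ⟨x, y, hxy, hnot⟩ := ih (by omega) (a - 1) (b + 1)
      (fun k => u ((f i).succAbove k)) (fun k => v ((f i).succAbove k))
      (fun k => w ((f i).succAbove k)) (fun k => huv _)
    obtain ⟨k, hk⟩ := hcon x (y + 1) (by omega)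
    by_cases hki : k = f i
    · subst hki
      have h1 := dvd_sub (dvd_sub hk (hf i)) (hu.mul_right (x - (y + 1 : ℕ) - (i : ℕ)))
      have h2 : (p : ℤ) ∣ v (f i) * ((y + 1 : ℕ) - (0 : ℕ)) := by
        exact int_dvd_congr (h1) rfl (by push_cast; ring)
      have h3 := int_eq_of_dvd_sub (by omega) (by omega) ((hpZ.dvd_or_dvd h2).resolve_left hv)
      omega
    · obtain ⟨k', rfl⟩ := Fin.exists_succAbove_eq hki
      refine hnot k' ?_
      exact int_dvd_congr (hk) rfl (by push_cast; ring)

/-- Without `(a, b)`, the triangle is covered by the `a` lines `i < a`, the `b` lines `j < b` and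
the `m - a - b` lines `i + j > a + b`. The shear makes these `x + y`, `y` and `x + 2 y` constant,
with `y`-coefficients prime to the odd `p`; unsheared, the lines of constant `i` would be vertical.
-/
theorem finelyCoveredMod_triangle_erase {p : ℕ} (hp : p.Prime) (hp2 : p ≠ 2) (e n m : ℕ) :
    ∀ P ∈ triangle m, FinelyCoveredMod p e n m ((triangle m).erase P) := by
  have hpZ := Nat.prime_iff_prime_int.1 hp
  have hp2' : ¬ (p : ℤ) ∣ 2 := by
    intro h
    have h : p ∣ 2 := by exact_mod_cast h
    exact hp2 ((Nat.prime_dvd_prime_iff_eq hp Nat.prime_two).1 h)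
  intro P hP
  obtain ⟨a, b, hab, rfl⟩ := mem_triangle.1 hP
  refine ⟨0, fun k => if (k : ℕ) < a then 1 else if (k : ℕ) < a + b then 0 else 1,
    fun k => if (k : ℕ) < a + b then 1 else 2,
    fun k => if (k : ℕ) < a then (k : ℕ) + m else if (k : ℕ) < a + b then (k : ℕ) - a
      else (k : ℕ) + 1 + m, ?_, ?_⟩
  · intro k
    refine ⟨by simp, ?_, Or.inl rfl⟩
    simp only
    split_ifs
    · exact hpZ.not_dvd_one
    · exact hp2'
  · intro Q hQ
    obtain ⟨hne, hQ⟩ := Finset.mem_erase.1 hQ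
    obtain ⟨i, j, hij, rfl⟩ := mem_triangle.1 hQ
    by_cases hi : i < a
    · refine ⟨⟨i, by omega⟩, ?_⟩
      have : i < a + b := by omega
      simp only [hi, this, if_true, Pi.zero_apply]
      exact int_dvd_congr (dvd_zero _) rfl (by ring)
    by_cases hj : j < b
    · refine ⟨⟨a + j, by omega⟩, ?_⟩
      simp [hj]
    · have hlt : a + b < i + j := by
        by_contra hle
        exact hne (by rw [show i = a by omega, show j = b by omega])
      refine ⟨⟨i + j - 1, by omega⟩, ?_⟩
      have h1 : ¬ (i + j - 1 < a) := by omega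
      have h2 : ¬ (i + j - 1 < a + b) := by omega
      have h3 : ((i + j - 1 : ℕ) : ℤ) = i + j - 1 := by omega
      simp only [h1, h2, h3, if_false, Pi.zero_apply]
      have : (1 : ℤ) * ((i : ℤ) - j + m) + (p : ℤ) ^ 0 * 2 * j - ((i : ℤ) + j - 1 + 1 + m) = 0 := by
        ring
      rw [this]
      exact dvd_zero _

theorem finelyNearlyCovered_triangle {p : ℕ} (hp : p.Prime) (hp2 : p ≠ 2) (e n m : ℕ)
    (hn : 1 ≤ n) (hm : 2 * m < p) :
    FinelyNearlyCovered p e n m (2 * m + 1) (triangle m) where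
  not_covered := by
    rintro ⟨u, v, w, huv, hcov⟩
    obtain ⟨i, j, hij, hnot⟩ :=
      exists_triangle_point_not_covered hp m (by omega) m 0 u v w huv
    obtain ⟨k, hk⟩ := hcov _ (mem_triangle.2 ⟨i, j, hij, rfl⟩)
    exact hnot k (by simpa using (dvd_pow_self (p : ℤ) (by omega : n ≠ 0)).trans hk)
  covered_erase := finelyCoveredMod_triangle_erase hp hp2 e n m
  injOn := by
    intro P hP Q hQ h1 h2
    obtain ⟨i, j, hij, rfl⟩ := mem_triangle.1 hP
    obtain ⟨i', j', hij', rfl⟩ := mem_triangle.1 hQ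
    have hd := dvd_pow_self (p : ℤ) (by omega : n ≠ 0)
    have hj : j = j' := int_eq_of_dvd_sub (by omega) (by omega) (hd.trans h2)
    subst hj
    have hi : i = i' := by
      refine int_eq_of_dvd_sub (p := p) (by omega) (by omega) ?_
      exact int_dvd_congr (hd.trans h1) rfl (by ring)
    rw [hi]
  abscissa := by
    intro P hP
    obtain ⟨i, j, hij, rfl⟩ := mem_triangle.1 hP
    refine ⟨i + m - j, by omega, ?_⟩
    have : (i : ℤ) - j + m - ((i + m - j : ℕ) : ℤ) = 0 := by omega
    simp only [this, dvd_zero]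

/-! ### Iterated doubling -/

theorem exists_finelyNearlyCovered {p : ℕ} (hp : p.Prime) (hp2 : p ≠ 2) (e n m : ℕ) (hn : 1 ≤ n)
    (hm : 2 * m < p) (M : ℕ) (hM : 2 * m + M < p ^ (e + 1)) :
    ∃ S : Finset (ℤ × ℤ), S.card + 1 = 2 ^ M * ((m + 2).choose 2 + 1) ∧
      FinelyNearlyCovered p e (n + M * (e + 1)) (m + M) (2 * m + 1 + M) S := by
  induction M with
  | zero =>
    exact ⟨triangle m, by simp [card_triangle],
      by simpa using finelyNearlyCovered_triangle hp hp2 e n m hn hm⟩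
  | succ M ih =>
    obtain ⟨S, hcard, hS⟩ := ih (by omega)
    refine ⟨flatDouble p e (n + M * (e + 1)) (2 * m + 1 + M) S, ?_, ?_⟩
    · rw [card_flatDouble hp hS.injOn, pow_succ]
      linarith
    -- The new abscissa `2 * m + 1 + M` is below `p ^ (e + 1)` by `hM`.
    · have h := hS.flatDouble hp (by omega) (by omega)
      have h1 : n + M * (e + 1) + (e + 1) = n + (M + 1) * (e + 1) := by ring
      rw [h1] at h
      exact h

/-! ### From congruences to lines over `ZMod (p ^ k)` -/

theorem isUnit_intCast_zmod_pow_iff {p k : ℕ} (hp : p.Prime) (hk : 1 ≤ k) (a : ℤ) :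
    IsUnit (a : ZMod (p ^ k)) ↔ ¬ (p : ℤ) ∣ a := by
  have hpZ := Nat.prime_iff_prime_int.1 hp
  constructor
  · intro h hdvd
    have h1 := h.map (ZMod.castHom (dvd_pow_self p (by omega : k ≠ 0)) (ZMod p))
    have h2 : (a : ZMod p) = 0 := (ZMod.intCast_zmod_eq_zero_iff_dvd a p).2 hdvd
    have := Fact.mk hp
    simp [h2] at h1
  · intro h
    have hc : IsCoprime a ((p : ℤ) ^ k) :=
      (IsCoprime.pow_left ((Prime.coprime_iff_not_dvd hpZ).2 h)).symm
    obtain ⟨x, y, hxy⟩ := hc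
    have h1 : ((x * a + y * (p : ℤ) ^ k : ℤ) : ZMod (p ^ k)) = 1 := by rw [hxy]; simp
    have h2 : ((p : ZMod (p ^ k))) ^ k = 0 := by
      exact_mod_cast ZMod.natCast_self (p ^ k)
    push_cast at h1
    rw [h2, mul_zero, add_zero] at h1
    exact IsUnit.of_mul_eq_one_right _ h1

/-- Reduction of an integer point modulo `q`. -/
def toZModPlane (q : ℕ) (P : ℤ × ℤ) : Fin 2 → ZMod q := ![(P.1 : ZMod q), (P.2 : ZMod q)]

theorem coveredMod_of_isCoveredByLines {p k m : ℕ} (hp : p.Prime) (hk : 1 ≤ k)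
    {S : Finset (ℤ × ℤ)}
    (h : IsCoveredByLines m (toZModPlane (p ^ k) '' (S : Set (ℤ × ℤ)))) : CoveredMod p k m S := by
  obtain ⟨L, hL, hcov⟩ := h
  choose a b hb hLab using hL
  choose b' hb' using fun (i : Fin m) (j : Fin 2) => ZMod.intCast_surjective (b i j)
  choose w hw using fun i : Fin m => ZMod.intCast_surjective (b i 1 * a i 0 - b i 0 * a i 1)
  refine ⟨fun i => b' i 1, fun i => - b' i 0, w, ?_, ?_⟩
  · rintro i ⟨h1, h0⟩
    obtain ⟨j, hj⟩ := hb i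
    rw [← hb' i j, isUnit_intCast_zmod_pow_iff hp hk] at hj
    refine hj ?_
    fin_cases j
    · simpa using h0
    · exact h1
  · intro P hP
    obtain ⟨i, hi⟩ := Set.mem_iUnion.1 (hcov ⟨P, hP, rfl⟩)
    refine ⟨i, ?_⟩
    rw [hLab i] at hi
    obtain ⟨s, hs⟩ := hi
    have h0 : (P.1 : ZMod (p ^ k)) = a i 0 + s * b i 0 := by
      simpa [toZModPlane] using congrFun hs 0
    have h1 : (P.2 : ZMod (p ^ k)) = a i 1 + s * b i 1 := by
      simpa [toZModPlane] using congrFun hs 1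
    have h2 := (ZMod.intCast_zmod_eq_zero_iff_dvd
      (b' i 1 * P.1 + - b' i 0 * P.2 - w i) (p ^ k)).1 (by
        push_cast
        rw [hb', hb', hw, h0, h1]
        ring)
    exact_mod_cast h2

theorem exists_isLine_of_equation {R : Type*} [CommRing R] {u v w : R}
    (h : IsUnit u ∨ IsUnit v) :
    ∃ L : Set (Fin 2 → R), IsLine L ∧ ∀ x y : R, u * x + v * y = w → ![x, y] ∈ L := by
  rcases h with h | h
  · obtain ⟨c, hc⟩ := h.exists_right_inv
    refine ⟨_, ⟨![c * w, 0], ![v, -u], ⟨1, by simpa using h⟩, rfl⟩, fun x y hxy =>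
      ⟨-(c * y), ?_⟩⟩
    ext j
    fin_cases j
    · simp only [Fin.zero_eta, Matrix.cons_val_zero, Pi.add_apply, Pi.smul_apply, smul_eq_mul]
      linear_combination (-x) * hc + c * hxy
    · simp only [Fin.mk_one, Matrix.cons_val_one, Pi.add_apply,
        Pi.smul_apply, smul_eq_mul, Matrix.cons_val_fin_one]
      linear_combination (-y) * hc
  · obtain ⟨c, hc⟩ := h.exists_right_inv
    refine ⟨_, ⟨![0, c * w], ![v, -u], ⟨0, by simpa using h⟩, rfl⟩, fun x y hxy =>
      ⟨c * x, ?_⟩⟩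
    ext j
    fin_cases j
    · simp only [Fin.zero_eta, Matrix.cons_val_zero, Pi.add_apply, Pi.smul_apply, smul_eq_mul]
      linear_combination (-x) * hc
    · simp only [Fin.mk_one, Matrix.cons_val_one, Pi.add_apply,
        Pi.smul_apply, smul_eq_mul, Matrix.cons_val_fin_one]
      linear_combination (-y) * hc + c * hxy

theorem CoveredMod.isCoveredByLines {p k m : ℕ} (hp : p.Prime) (hk : 1 ≤ k)
    {S : Finset (ℤ × ℤ)} (h : CoveredMod p k m S) :
    IsCoveredByLines m (toZModPlane (p ^ k) '' (S : Set (ℤ × ℤ))) := by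
  obtain ⟨u, v, w, huv, hcov⟩ := h
  have hunit : ∀ i, IsUnit (u i : ZMod (p ^ k)) ∨ IsUnit (v i : ZMod (p ^ k)) := by
    intro i
    rw [isUnit_intCast_zmod_pow_iff hp hk, isUnit_intCast_zmod_pow_iff hp hk]
    exact not_and_or.1 (huv i)
  choose L hL hmem using fun i =>
    exists_isLine_of_equation (w := (w i : ZMod (p ^ k))) (hunit i)
  refine ⟨L, hL, ?_⟩
  rintro _ ⟨P, hP, rfl⟩
  obtain ⟨i, hi⟩ := hcov P hP
  refine Set.mem_iUnion.2 ⟨i, hmem i _ _ ?_⟩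
  have h1 := (ZMod.intCast_zmod_eq_zero_iff_dvd (u i * P.1 + v i * P.2 - w i) (p ^ k)).2
    (by exact_mod_cast hi)
  push_cast at h1
  exact sub_eq_zero.1 h1

theorem IsCoveredByLines.mono {R : Type*} [CommRing R] {n t : ℕ} {S T : Set (Fin n → R)}
    (h : IsCoveredByLines t T) (hST : S ⊆ T) : IsCoveredByLines t S := by
  obtain ⟨L, hL, hT⟩ := h
  exact ⟨L, hL, hST.trans hT⟩

theorem FinelyNearlyCovered.isNearlyCoveredByLines {p e k m r : ℕ} (hp : p.Prime) (hk : 1 ≤ k)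
    {S : Finset (ℤ × ℤ)} (h : FinelyNearlyCovered p e k m r S) :
    IsNearlyCoveredByLines m (toZModPlane (p ^ k) '' (S : Set (ℤ × ℤ))) := by
  refine ⟨fun hc => h.not_covered (coveredMod_of_isCoveredByLines hp hk hc), fun T hT => ?_⟩
  obtain ⟨_, ⟨P, hP, rfl⟩, hPT⟩ := Set.exists_of_ssubset hT
  refine ((h.covered_erase P hP).coveredMod.isCoveredByLines hp hk).mono fun Q hQ => ?_
  obtain ⟨A, hA, rfl⟩ := hT.1 hQ
  refine ⟨A, ?_, rfl⟩
  rw [Finset.mem_coe, Finset.mem_erase]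
  refine ⟨?_, hA⟩
  rintro rfl
  exact hPT hQ

theorem FinelyNearlyCovered.injOn_toZModPlane {p e k m r : ℕ} {S : Finset (ℤ × ℤ)}
    (h : FinelyNearlyCovered p e k m r S) :
    Set.InjOn (toZModPlane (p ^ k)) (S : Set (ℤ × ℤ)) := by
  have key : ∀ a b : ℤ, (a : ZMod (p ^ k)) = b → (p : ℤ) ^ k ∣ a - b := by
    intro a b hab
    have h1 := (ZMod.intCast_zmod_eq_zero_iff_dvd (a - b) (p ^ k)).1 (by
      push_cast
      rw [hab, sub_self])
    exact_mod_cast h1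
  intro P hP Q hQ hPQ
  exact h.injOn P hP Q hQ (key _ _ (by simpa [toZModPlane] using congrFun hPQ 0))
    (key _ _ (by simpa [toZModPlane] using congrFun hPQ 1))

/-! ### Numerical estimates and conclusion -/

/-- The case `M = 0` amounts to `0 < t.choose 2`. Then each step adds `t + M + 2` on the left, at
most the previous left side, and doubles the right. -/
theorem choose_two_add_lt (t M : ℕ) (ht : 2 ≤ t) :
    (t + M + 2).choose 2 + 1 < 2 ^ (M + 1) * ((t + 1).choose 2 + 1) := by
  induction M with
  | zero =>
    have h1 : (t + 2).choose 2 = (t + 1) + (t + 1).choose 2 := by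
      rw [Nat.choose_succ_succ' (t + 1) 1, Nat.choose_one_right]
    have h2 : (t + 1).choose 2 = t + t.choose 2 := by
      rw [Nat.choose_succ_succ' t 1, Nat.choose_one_right]
    have h3 : 0 < t.choose 2 := Nat.choose_pos ht
    simp only [add_zero, zero_add, pow_one]
    omega
  | succ M ih =>
    have h1 : (t + (M + 1) + 2).choose 2 = (t + M + 2) + (t + M + 2).choose 2 := by
      rw [show t + (M + 1) + 2 = (t + M + 2) + 1 by ring, Nat.choose_succ_succ' (t + M + 2) 1,
        Nat.choose_one_right]
    have h2 : (t + M + 2).choose 2 = (t + M + 1) + (t + M + 1).choose 2 := by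
      rw [Nat.choose_succ_succ' (t + M + 1) 1, Nat.choose_one_right]
    have h3 : 0 < (t + M + 1).choose 2 := Nat.choose_pos (by omega)
    rw [pow_succ, h1]
    linarith

theorem scaleStep_pos (p k : ℕ) : 1 ≤ scaleStep p k := by
  unfold scaleStep
  split_ifs <;> omega

theorem scaleCount_mul_scaleStep_lt {p k : ℕ} (hk : 2 ≤ k) :
    scaleCount p k * scaleStep p k < k := by
  unfold scaleCount
  split_ifs with h
  · simp [scaleStep, h]
  · exact lt_of_le_of_lt (Nat.div_mul_le_self _ _) (by omega)

/-- For `k ≥ 3` this rests on `k < 4 ^ (k - 2)`. It fails for `p = k = 3`. -/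
theorem scaleCount_pos {p k : ℕ} (hp : 4 ≤ p) (hk : 2 ≤ k) : 1 ≤ scaleCount p k := by
  unfold scaleCount
  split_ifs with h
  · rfl
  · rw [Nat.one_le_div_iff (scaleStep_pos p k), scaleStep, if_neg h]
    suffices Nat.log p k < k - 2 from by omega
    obtain ⟨j, rfl⟩ : ∃ j, k = j + 3 := ⟨k - 3, by omega⟩
    refine Nat.log_lt_of_lt_pow (by omega) (lt_of_lt_of_le ?_ (Nat.pow_le_pow_left hp _))
    rw [show j + 3 - 2 = j + 1 by omega]
    clear h hk
    induction j with
    | zero => norm_num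
    | succ j ih => rw [pow_succ]; omega

/-- This explains `ℓ`: one power of `p` beyond `Nat.log p k` exceeds `k`, hence `M`, and one more
leaves room for `a < p`. -/
theorem add_scaleCount_lt {p k a : ℕ} (hk : 2 ≤ k) (ha : a + 1 < p) :
    a + scaleCount p k < p ^ scaleStep p k := by
  by_cases h : k = 2
  · simpa [scaleCount, scaleStep, h] using ha
  · have h1 : scaleCount p k < k := lt_of_le_of_lt
      (Nat.le_mul_of_pos_right _ (scaleStep_pos p k)) (scaleCount_mul_scaleStep_lt hk)
    have h2 : k < p ^ (Nat.log p k + 1) := Nat.lt_pow_succ_log_self (by omega) k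
    rw [show scaleStep p k = Nat.log p k + 1 + 1 by simp [scaleStep, h],
      pow_succ _ (Nat.log p k + 1)]
    nlinarith

theorem mainTheorem6 (p k t : ℕ) (hp : p.Prime) (hk : 2 ≤ k) (ht : 2 ≤ t)
    (htp : (t : ℝ) < Real.sqrt (p : ℝ) / 4) :
    ∃ S : Finset (Fin 2 → ZMod (p ^ k)),
      S.card = 2 ^ scaleCount p k * (t + 1).choose 2 + 2 ^ scaleCount p k - 1 ∧
      IsNearlyCoveredByLines (t + scaleCount p k - 1) (S : Set (Fin 2 → ZMod (p ^ k))) ∧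
      ((t + scaleCount p k - 1) + 2).choose 2 < S.card ∧
      (3 ≤ k → k < p →
        scaleStep p k = 2 ∧ scaleCount p k = (k - 1) / 2 ∧
        S.card = 2 ^ ((k - 1) / 2) * ((t + 1).choose 2 + 1) - 1) := by
  have hpt : 16 * t ^ 2 < p := by
    have h1 : (4 * (t : ℝ)) < Real.sqrt p := by linarith
    have h2 := (Real.lt_sqrt (by positivity)).1 h1
    have h3 : (16 * (t : ℝ) ^ 2) < p := by linarith
    exact_mod_cast h3
  have hpt' : 2 * t + 3 < p := by nlinarith
  obtain ⟨m, rfl⟩ : ∃ m, t = m + 1 := ⟨t - 1, by omega⟩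
  obtain ⟨e, he⟩ : ∃ e, scaleStep p k = e + 1 :=
    ⟨scaleStep p k - 1, by have := scaleStep_pos p k; omega⟩
  have hM1 : 1 ≤ scaleCount p k := scaleCount_pos (by omega) hk
  have hMk := scaleCount_mul_scaleStep_lt (p := p) hk
  have hMp := add_scaleCount_lt (p := p) (a := 2 * m) hk (by omega)
  have hspec : 3 ≤ k → k < p → scaleStep p k = 2 ∧ scaleCount p k = (k - 1) / 2 := by
    intro h3 hkp
    have hs : scaleStep p k = 2 := by
      rw [scaleStep, if_neg (by omega), Nat.log_of_lt hkp]
    exact ⟨hs, by rw [scaleCount, if_neg (by omega), hs]⟩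
  rw [he] at hMk hMp
  set M := scaleCount p k with hM
  -- The doublings use `M * ℓ < k` of the exponent; the positive remainder is the exponent for the
  -- starting triangle.
  obtain ⟨n, hn⟩ : ∃ n, k = n + 1 + M * (e + 1) :=
    ⟨k - 1 - M * (e + 1), by omega⟩
  obtain ⟨S, hcard, hS⟩ :=
    exists_finelyNearlyCovered hp (by omega) e (n + 1) m (by omega) (by omega) M hMp
  rw [← hn] at hS
  have hcard' : (S.image (toZModPlane (p ^ k))).card + 1 =
      2 ^ M * ((m + 1 + 1).choose 2 + 1) := by
    rw [Finset.card_image_of_injOn hS.injOn_toZModPlane, hcard]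
  refine ⟨S.image (toZModPlane (p ^ k)), ?_, ?_, ?_, ?_⟩
  · rw [mul_add, mul_one] at hcard'
    omega
  · rw [Finset.coe_image, show m + 1 + M - 1 = m + M by omega]
    exact hS.isNearlyCoveredByLines hp (by omega)
  · obtain ⟨N, hN⟩ : ∃ N, M = N + 1 := ⟨M - 1, by omega⟩
    have h1 := choose_two_add_lt (m + 1) N ht
    rw [← hN, ← hcard'] at h1
    rw [show m + 1 + M - 1 + 2 = m + 1 + N + 2 by omega]
    omega
  · intro h3 hkp
    obtain ⟨h4, h5⟩ := hspec h3 hkp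
    refine ⟨h4, h5, ?_⟩
    rw [← h5]
    omega
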